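/- Work on the triangular lattice with horizontal lattice lines, in coordinates $(i,j)$ whose horizontal unit is half the side of a unit triangle and whose vertical unit is the height of a unit triangle; the origin is a lattice vertex, so the lattice vertices are the integer points with $i+j$ even. Let $x,n\ge 0$ be integers and let $1\le s_1<s_2<\dots<s_n\le n+x$ be integers. Consider the right trapezoidal region consisting of $2n-1$ rows of unit triangles with sides of lengths $x,2n-1,x+n,2n-1$ (north, west, south, northeast), whose base is the segment from $(0,0)$ to $(2(x+n),0)$, whose northeast side is the lattice line from $(2(x+n),0)$ to $(2x+1,2n-1)$, and whose west side is the vertical zigzag through $(0,0),(1,1),(0,2),(1,3),\dots,(1,2n-1)$ (for $n=0$ the region is empty). Let $R^1_x(s_1,\dots,s_n)$ be obtained by removing, for each $k$, the $s_k$-th up-pointing unit triangle along the base, counted from the left. A vertical lozenge (the union of two unit triangles sharing a horizontal edge) with center $(i,j)$ has weight $\frac{q^i+q^{-i}}{2}$, all other lozenges have weight $1$, the weight of a lozenge tiling is the product of the weights of its lozenges, and $\operatorname{M}(R^1_x(s_1,\dots,s_n))$ is the sum of the weights of all lozenge tilings of the region (so it is $1$ for the empty region). Put $[m]_q=1+q+\dots+q^{m-1}$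 and $[m]_q!=[1]_q[2]_q\cdots[m]_q$. Let $q$ be an element of a field in which $2\neq0$, $q\ne0$, and $[m]_{q^2}\neq 0$ for $1\le m\le 2n-2$ (for example an indeterminate, or any nonzero real number). Then $$\operatorname{M}(R^{1}_{x}(s_1,\dots,s_n))=2^{-n(n-1)}\,q^{-\sum_{i=1}^n(i-1)(4s_i-2i-1)}\,\frac{\prod_{1\le i<j\le n}[2(s_i+s_j-1)]_{q^2}\,[2(s_j-s_i)]_{q^2}}{\prod_{i=1}^{n}[2i-2]_{q^2}!}$$ $$=2^{-n(n-1)}\,q^{-\sum_{i=1}^n(i-1)(4s_i-2i-1)}\prod_{1\le i<j\le n}\frac{[2(s_i+s_j-1)]_{q^2}}{[i+j-1]_{q^2}}\prod_{1\le i<j\le n}\frac{[2(s_j-s_i)]_{q^2}}{[j-i]_{q^2}}.$$ -/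

import Mathlib

/-! The plane carries the coordinates in which half the side of a unit triangle is the horizontal
unit and the height of a unit triangle is the vertical unit. The vertices of the triangular lattice
are the integer points `(a, b)` with `a + b` even. -/

/-- A unit triangle of the triangular lattice is encoded by `(i, j)`, where `i` is the abscissa of
its vertical axis of symmetry and the triangle lies between the horizontal lines of heights `j`
and `j + 1`. If `i + j` is odd it is the up-pointing triangle with vertices
`(i - 1, j)`, `(i + 1, j)`, `(i, j + 1)`; if `i + j` is even it is the down-pointing triangle with
vertices `(i - 1, j + 1)`, `(i + 1, j + 1)`, `(i, j)`. -/
abbrev UnitTriangle := ℤ × ℤ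

/-- The up-pointing unit triangles. -/
def UnitTriangle.IsUp (t : UnitTriangle) : Prop := Odd (t.1 + t.2)

instance : DecidablePred UnitTriangle.IsUp := fun t => inferInstanceAs (Decidable (Odd (t.1 + t.2)))

/-- `(u, d)` is a lozenge: `u` is an up-pointing unit triangle and `d` is one of the three
(down-pointing) unit triangles that share an edge with `u`: the one to the left of `u`, the one to
the right of `u`, or the one below `u`. In the last case the lozenge is vertical, and its center is
the midpoint of the base of `u`, which is the point with coordinates `u`. -/
def IsLozenge (l : UnitTriangle × UnitTriangle) : Prop :=
  l.1.IsUp ∧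
    (l.2 = (l.1.1 - 1, l.1.2) ∨ l.2 = (l.1.1 + 1, l.1.2) ∨ l.2 = (l.1.1, l.1.2 - 1))

instance : DecidablePred IsLozenge := fun _ => by unfold IsLozenge; infer_instance

/-- The lozenges contained in the region `R` (a finite set of unit triangles). -/
def lozengesIn (R : Finset UnitTriangle) : Finset (UnitTriangle × UnitTriangle) :=
  (R ×ˢ R).filter IsLozenge

/-- The lozenge tilings of `R`: the sets of lozenges contained in `R` such that every unit triangle
of `R` belongs to exactly one of them. -/
def tilings (R : Finset UnitTriangle) : Finset (Finset (UnitTriangle × UnitTriangle)) :=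
  (lozengesIn R).powerset.filter fun T =>
    ∀ t ∈ R, (T.filter fun l => t = l.1 ∨ t = l.2).card = 1

/-- The symmetric weight: a vertical lozenge with center `(i, j)` has weight `(q^i + q^(-i)) / 2`,
every other lozenge has weight `1`. -/
def symmetricWeight {K : Type*} [Field K] (q : K) (l : UnitTriangle × UnitTriangle) : K :=
  if l.2 = (l.1.1, l.1.2 - 1) then (q ^ l.1.1 + q ^ (-l.1.1)) / 2 else 1

/-- The tiling generating function of `R` for the symmetric weight. -/
def tilingGF {K : Type*} [Field K] (q : K) (R : Finset UnitTriangle) : K :=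
  ∑ T ∈ tilings R, ∏ l ∈ T, symmetricWeight q l

/-- The right trapezoid with north side `x`, base `x + n` on the horizontal axis, and `2 n - 1` rows
of unit triangles. The west side is the vertical zigzag through the points
`(0, 0), (1, 1), (0, 2), (1, 3), …, (1, 2 n - 1)`, so that the vertical axis touches it from the
west; the northeast side is the lattice line from `(2 (x + n), 0)` to `(2 x + 1, 2 n - 1)`. -/
noncomputable def trapezoid (x n : ℕ) : Finset UnitTriangle :=
  (Finset.Icc (1 : ℤ) (2 * (x + n) - 1) ×ˢ Finset.Ico (0 : ℤ) (2 * n - 1)).filter fun t =>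
    t.1 + t.2 ≤ 2 * (x + n) - 1

/-- The `s`-th up-pointing unit triangle, `s = 1, 2, …`, along the base, counted from the left: its
base is the segment from `(2 (s - 1), 0)` to `(2 s, 0)`. -/
def baseTriangle (s : ℕ) : UnitTriangle := (2 * (s : ℤ) - 1, 0)

/-- The quartered hexagon: the trapezoid with dents at the positions `s 0, …, s (n - 1)`. -/
noncomputable def quarteredHexagon (x : ℕ) {n : ℕ} (s : Fin n → ℕ) : Finset UnitTriangle :=
  trapezoid x n \ Finset.univ.image fun i => baseTriangle (s i)

/-- The `q`-integer `[m]_q = 1 + q + ⋯ + q^(m-1)`. -/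
def qInt {K : Type*} [Field K] (q : K) (m : ℕ) : K := ∑ k ∈ Finset.range m, q ^ k

/-- The `q`-factorial `[m]_q! = [1]_q [2]_q ⋯ [m]_q`. -/
def qFactorial {K : Type*} [Field K] (q : K) (m : ℕ) : K :=
  ∏ k ∈ Finset.range m, qInt q (k + 1)

/-! Cut the region into its rows of unit triangles. Once the vertical lozenges crossing the two
sides of a row are chosen, the rest of the row is an interval with gaps that has to be covered by
pairs of neighbouring triangles: this can be done in at most one way, and it can be done exactly
when the vertical lozenges on the upper side interlace with those on the lower side. The weighted
count is thus an iterated sum over interlacing sequences. The central factorials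
`[t + k - 1] [t + k - 3] ⋯ [t - k + 1]`, built from symmetric `q`-numbers, have central differences
which are, up to a constant, central factorials times the weight `(q^t + q^(-t)) / 2`. Hence
each summation turns a determinant of central factorials into another one, and the last determinant
is a Vandermonde determinant in the squares `[2 s_i - 1]^2`, whose factors are
`[2 s_j - 1]^2 - [2 s_i - 1]^2 = [2 (s_i + s_j - 1)] [2 (s_j - s_i)]`. -/

section Tilings

/-- The two unit triangles of a lozenge. -/
def lozengeTriangles (l : UnitTriangle × UnitTriangle) : Finset UnitTriangle := {l.1, l.2}

/-- The total weight of the lozenge tilings of `R`, where a tiling is weighted by the product of the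
weights `w l` of its lozenges: `tilingGF` for an arbitrary weight. -/
def tilingSum {M : Type*} [CommSemiring M] (w : UnitTriangle × UnitTriangle → M)
    (R : Finset UnitTriangle) : M :=
  ∑ T ∈ tilings R, ∏ l ∈ T, w l

variable {M : Type*} [CommSemiring M] {R R₀ R₁ : Finset UnitTriangle}
  {T T₀ T₁ C : Finset (UnitTriangle × UnitTriangle)} {l : UnitTriangle × UnitTriangle}
  {t : UnitTriangle}

theorem mem_lozengeTriangles : t ∈ lozengeTriangles l ↔ t = l.1 ∨ t = l.2 := by
  simp [lozengeTriangles]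

theorem mem_lozengesIn : l ∈ lozengesIn R ↔ IsLozenge l ∧ lozengeTriangles l ⊆ R := by
  simp only [lozengesIn, lozengeTriangles, Finset.mem_filter, Finset.mem_product,
    Finset.insert_subset_iff, Finset.singleton_subset_iff]
  tauto

theorem mem_tilings_iff_existsUnique :
    T ∈ tilings R ↔
      (∀ l ∈ T, l ∈ lozengesIn R) ∧ ∀ t ∈ R, ∃! l, l ∈ T ∧ t ∈ lozengeTriangles l := by
  simp only [tilings, Finset.mem_filter, Finset.mem_powerset, Finset.subset_iff,
    ← mem_lozengeTriangles, Finset.card_eq_one, Finset.eq_singleton_iff_unique_mem, ExistsUnique]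

theorem mem_tilings :
    T ∈ tilings R ↔ (∀ l ∈ T, IsLozenge l) ∧
      (T : Set (UnitTriangle × UnitTriangle)).PairwiseDisjoint lozengeTriangles ∧
      T.biUnion lozengeTriangles = R := by
  rw [mem_tilings_iff_existsUnique]
  constructor
  · rintro ⟨hT, hR⟩
    refine ⟨fun l hl => (mem_lozengesIn.1 (hT l hl)).1, fun l hl l' hl' hne => ?_, ?_⟩
    · refine Finset.disjoint_left.2 fun t ht ht' => hne ?_
      exact (hR t ((mem_lozengesIn.1 (hT l hl)).2 ht)).unique ⟨hl, ht⟩ ⟨hl', ht'⟩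
    · refine (Finset.biUnion_subset.2 fun l hl => (mem_lozengesIn.1 (hT l hl)).2).antisymm
        fun t ht => ?_
      exact Finset.mem_biUnion.2 (hR t ht).exists
  · rintro ⟨hT, hdisj, rfl⟩
    refine ⟨fun l hl => mem_lozengesIn.2 ⟨hT l hl, Finset.subset_biUnion_of_mem _ hl⟩,
      fun t ht => ?_⟩
    obtain ⟨l, hl, htl⟩ := Finset.mem_biUnion.1 ht
    exact ⟨l, ⟨hl, htl⟩, fun l' hl' => hdisj.elim_finset hl'.1 hl t hl'.2 htl⟩

theorem subset_lozengesIn_of_mem_tilings (hT : T ∈ tilings R) : T ⊆ lozengesIn R :=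
  fun l hl => (mem_tilings_iff_existsUnique.1 hT).1 l hl

theorem singleton_mem_tilings (hl : IsLozenge l) : {l} ∈ tilings (lozengeTriangles l) :=
  mem_tilings.2 (by simpa using hl)

theorem union_mem_tilings (h₀ : T₀ ∈ tilings R₀) (h₁ : T₁ ∈ tilings R₁) (hd : Disjoint R₀ R₁) :
    T₀ ∪ T₁ ∈ tilings (R₀ ∪ R₁) := by
  rw [mem_tilings] at *
  obtain ⟨hl₀, hd₀, rfl⟩ := h₀
  obtain ⟨hl₁, hd₁, rfl⟩ := h₁
  refine ⟨fun l hl => (Finset.mem_union.1 hl).elim (hl₀ l) (hl₁ l), ?_, Finset.union_biUnion⟩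
  rw [Finset.coe_union, Set.pairwiseDisjoint_union]
  refine ⟨hd₀, hd₁, fun l hl l' hl' _ => ?_⟩
  exact hd.mono (Finset.subset_biUnion_of_mem _ hl) (Finset.subset_biUnion_of_mem _ hl')

theorem mem_tilings_of_subset (hT : T ∈ tilings R) (hC : C ⊆ T) :
    C ∈ tilings (C.biUnion lozengeTriangles) := by
  rw [mem_tilings] at *
  exact ⟨fun l hl => hT.1 l (hC hl), hT.2.1.subset (Finset.coe_subset.2 hC), rfl⟩

theorem sdiff_mem_tilings (hT : T ∈ tilings R) (hC : C ⊆ T) :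
    T \ C ∈ tilings (R \ C.biUnion lozengeTriangles) := by
  have hmem := mem_tilings_of_subset hT Finset.sdiff_subset (C := T \ C)
  obtain ⟨-, hd, rfl⟩ := mem_tilings.1 hT
  convert hmem using 2
  ext t
  simp only [Finset.mem_sdiff, Finset.mem_biUnion, not_exists, not_and]
  constructor
  · rintro ⟨⟨l, hl, ht⟩, hn⟩
    exact ⟨l, ⟨hl, fun h => hn l h ht⟩, ht⟩
  · rintro ⟨l, ⟨hl, hlC⟩, ht⟩
    refine ⟨⟨l, hl, ht⟩, fun l' hl' ht' => hlC ?_⟩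
    rwa [hd.elim_finset hl (hC hl') t ht ht']

theorem notMem_of_mem_tilings_sdiff (hT : T ∈ tilings (R \ lozengeTriangles l)) : l ∉ T := by
  intro hl
  have h := (mem_lozengesIn.1 (subset_lozengesIn_of_mem_tilings hT hl)).2
    (mem_lozengeTriangles.2 (Or.inl rfl))
  exact (Finset.mem_sdiff.1 h).2 (mem_lozengeTriangles.2 (Or.inl rfl))

theorem sum_tilings_containing (w : UnitTriangle × UnitTriangle → M) (hl : l ∈ lozengesIn R) :
    ∑ T ∈ tilings R with l ∈ T, ∏ l' ∈ T, w l' = w l * tilingSum w (R \ lozengeTriangles l) := by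
  obtain ⟨hloz, hsub⟩ := mem_lozengesIn.1 hl
  rw [tilingSum, Finset.mul_sum]
  refine Finset.sum_bij' (fun T _ => T \ {l}) (fun T _ => {l} ∪ T) ?_ ?_ ?_ ?_ ?_
  · intro T hT
    obtain ⟨hT, hlT⟩ := Finset.mem_filter.1 hT
    simpa using sdiff_mem_tilings hT (Finset.singleton_subset_iff.2 hlT)
  · intro T hT
    have := union_mem_tilings (singleton_mem_tilings hloz) hT Finset.disjoint_sdiff
    rw [Finset.union_sdiff_of_subset hsub] at this
    exact Finset.mem_filter.2 ⟨this, Finset.mem_union_left _ (Finset.mem_singleton_self l)⟩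
  · intro T hT
    exact Finset.union_sdiff_of_subset (Finset.singleton_subset_iff.2 (Finset.mem_filter.1 hT).2)
  · intro T hT
    exact Finset.union_sdiff_cancel_left
      (Finset.disjoint_singleton_left.2 (notMem_of_mem_tilings_sdiff hT))
  · intro T hT
    rw [Finset.sdiff_singleton_eq_erase, Finset.mul_prod_erase _ _ (Finset.mem_filter.1 hT).2]

theorem tilingSum_eq_sum_lozenges_through (w : UnitTriangle × UnitTriangle → M) (ht : t ∈ R) :
    tilingSum w R = ∑ l ∈ lozengesIn R with t ∈ lozengeTriangles l,
      w l * tilingSum w (R \ lozengeTriangles l) := by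
  have hone : ∀ T ∈ tilings R, ({l ∈ T | t ∈ lozengeTriangles l} : Finset _).card = 1 := by
    intro T hT
    simpa only [mem_lozengeTriangles] using (Finset.mem_filter.1 hT).2 t ht
  calc tilingSum w R
      = ∑ T ∈ tilings R, ∑ _l ∈ T with t ∈ lozengeTriangles _l, ∏ l' ∈ T, w l' := by
        refine Finset.sum_congr rfl fun T hT => ?_
        rw [Finset.sum_const, hone T hT, one_smul]
    _ = ∑ l ∈ lozengesIn R with t ∈ lozengeTriangles l,
          ∑ T ∈ tilings R with l ∈ T, ∏ l' ∈ T, w l' := by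
        refine Finset.sum_comm' fun T l => ?_
        simp only [Finset.mem_filter]
        exact ⟨fun ⟨hT, hl, h⟩ => ⟨⟨hT, hl⟩, subset_lozengesIn_of_mem_tilings hT hl, h⟩,
          fun ⟨⟨hT, hl⟩, _, h⟩ => ⟨hT, hl, h⟩⟩
    _ = _ := Finset.sum_congr rfl fun l hl =>
        sum_tilings_containing w (Finset.mem_filter.1 hl).1

theorem tilingSum_empty (w : UnitTriangle × UnitTriangle → M) : tilingSum w ∅ = 1 := by
  have : tilings ∅ = {∅} := by decide
  simp [tilingSum, this]

/-- The lozenges of which one unit triangle is in `R₀` and the other one in `R₁`, for disjoint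
regions `R₀` and `R₁`. -/
def crossingLozenges (R₀ R₁ : Finset UnitTriangle) : Finset (UnitTriangle × UnitTriangle) :=
  lozengesIn (R₀ ∪ R₁) \ (lozengesIn R₀ ∪ lozengesIn R₁)

theorem crossingLozenges_comm : crossingLozenges R₀ R₁ = crossingLozenges R₁ R₀ := by
  rw [crossingLozenges, Finset.union_comm, Finset.union_comm (lozengesIn R₀), crossingLozenges]

theorem disjoint_lozengesIn (hd : Disjoint R₀ R₁) : Disjoint (lozengesIn R₀) (lozengesIn R₁) := by
  refine Finset.disjoint_left.2 fun l h₀ h₁ => ?_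
  have hl : l.1 ∈ lozengeTriangles l := mem_lozengeTriangles.2 (Or.inl rfl)
  exact Finset.disjoint_left.1 hd ((mem_lozengesIn.1 h₀).2 hl) ((mem_lozengesIn.1 h₁).2 hl)

theorem inter_lozengesIn_mem_tilings (hd : Disjoint R₀ R₁) (hT : T ∈ tilings (R₀ ∪ R₁)) :
    T ∩ lozengesIn R₀ ∈
      tilings (R₀ \ (T ∩ crossingLozenges R₀ R₁).biUnion lozengeTriangles) := by
  convert mem_tilings_of_subset hT Finset.inter_subset_left (C := T ∩ lozengesIn R₀) using 2
  ext t
  simp only [Finset.mem_sdiff, Finset.mem_biUnion, Finset.mem_inter, not_exists, not_and]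
  have hsub := subset_lozengesIn_of_mem_tilings hT
  obtain ⟨-, hpd, hunion⟩ := mem_tilings.1 hT
  constructor
  · rintro ⟨ht, hn⟩
    obtain ⟨l, hl, htl⟩ := Finset.mem_biUnion.1 (hunion ▸ Finset.mem_union_left R₁ ht)
    refine ⟨l, ⟨hl, ?_⟩, htl⟩
    by_contra h₀
    have h₁ : l ∉ lozengesIn R₁ := fun h =>
      Finset.disjoint_left.1 hd ht ((mem_lozengesIn.1 h).2 htl)
    refine hn l ⟨hl, ?_⟩ htl
    exact Finset.mem_sdiff.2 ⟨hsub hl, by simp [h₀, h₁]⟩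
  · rintro ⟨l, ⟨hl, h₀⟩, htl⟩
    refine ⟨(mem_lozengesIn.1 h₀).2 htl, fun l' hl' htl' => ?_⟩
    have hcross := hpd.elim_finset hl hl'.1 t htl htl' ▸ hl'.2
    exact (Finset.mem_sdiff.1 hcross).2 (Finset.mem_union_left _ h₀)

theorem lozengesIn_mono (h : R₀ ⊆ R₁) : lozengesIn R₀ ⊆ lozengesIn R₁ := fun _ hl =>
  mem_lozengesIn.2 ⟨(mem_lozengesIn.1 hl).1, (mem_lozengesIn.1 hl).2.trans h⟩

theorem union_union_mem_tilings (hd : Disjoint R₀ R₁)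
    (hC : C ∈ tilings (C.biUnion lozengeTriangles)) (hCR : C ⊆ lozengesIn (R₀ ∪ R₁))
    (h₀ : T₀ ∈ tilings (R₀ \ C.biUnion lozengeTriangles))
    (h₁ : T₁ ∈ tilings (R₁ \ C.biUnion lozengeTriangles)) :
    C ∪ (T₀ ∪ T₁) ∈ tilings (R₀ ∪ R₁) := by
  have hsub : C.biUnion lozengeTriangles ⊆ R₀ ∪ R₁ :=
    Finset.biUnion_subset.2 fun l hl => (mem_lozengesIn.1 (hCR hl)).2
  rw [← Finset.union_sdiff_of_subset hsub, Finset.union_sdiff_distrib]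
  refine union_mem_tilings hC (union_mem_tilings h₀ h₁ ?_) ?_
  · exact hd.mono Finset.sdiff_subset Finset.sdiff_subset
  · rw [← Finset.union_sdiff_distrib]
    exact Finset.disjoint_sdiff

theorem union_crossingLozenges (h : T ⊆ lozengesIn (R₀ ∪ R₁)) :
    T ∩ crossingLozenges R₀ R₁ ∪ (T ∩ lozengesIn R₀ ∪ T ∩ lozengesIn R₁) = T := by
  rw [← Finset.inter_union_distrib_left, ← Finset.inter_union_distrib_left, crossingLozenges,
    Finset.sdiff_union_self_eq_union, Finset.inter_eq_left]
  exact h.trans Finset.subset_union_left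

theorem sum_tilings_with_crossing (w : UnitTriangle × UnitTriangle → M) (hd : Disjoint R₀ R₁)
    (hC : C ⊆ crossingLozenges R₀ R₁) (hCt : C ∈ tilings (C.biUnion lozengeTriangles)) :
    ∑ T ∈ tilings (R₀ ∪ R₁) with T ∩ crossingLozenges R₀ R₁ = C, ∏ l ∈ T, w l =
      (∏ l ∈ C, w l) * (tilingSum w (R₀ \ C.biUnion lozengeTriangles) *
        tilingSum w (R₁ \ C.biUnion lozengeTriangles)) := by
  have hd₀₁ := disjoint_lozengesIn hd
  have hdX₀ : Disjoint (crossingLozenges R₀ R₁) (lozengesIn R₀) :=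
    Finset.sdiff_disjoint.mono_right Finset.subset_union_left
  have hdX₁ : Disjoint (crossingLozenges R₀ R₁) (lozengesIn R₁) :=
    Finset.sdiff_disjoint.mono_right Finset.subset_union_right
  have hsub : ∀ p ∈ tilings (R₀ \ C.biUnion lozengeTriangles) ×ˢ
      tilings (R₁ \ C.biUnion lozengeTriangles),
      p.1 ⊆ lozengesIn R₀ ∧ p.2 ⊆ lozengesIn R₁ := fun p hp => by
    obtain ⟨h₀, h₁⟩ := Finset.mem_product.1 hp
    exact ⟨(subset_lozengesIn_of_mem_tilings h₀).trans (lozengesIn_mono Finset.sdiff_subset),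
      (subset_lozengesIn_of_mem_tilings h₁).trans (lozengesIn_mono Finset.sdiff_subset)⟩
  rw [tilingSum, tilingSum, Finset.sum_mul_sum, ← Finset.sum_product', Finset.mul_sum]
  symm
  refine Finset.sum_bij' (fun p _ => C ∪ (p.1 ∪ p.2))
    (fun T _ => (T ∩ lozengesIn R₀, T ∩ lozengesIn R₁)) ?_ ?_ ?_ ?_ ?_
  · intro p hp
    obtain ⟨h₀, h₁⟩ := Finset.mem_product.1 hp
    refine Finset.mem_filter.2
      ⟨union_union_mem_tilings hd hCt (hC.trans Finset.sdiff_subset) h₀ h₁, ?_⟩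
    grind [Finset.disjoint_left]
  · intro T hTC
    obtain ⟨hT, rfl⟩ := Finset.mem_filter.1 hTC
    refine Finset.mem_product.2 ⟨inter_lozengesIn_mem_tilings hd hT, ?_⟩
    rw [crossingLozenges_comm]
    exact inter_lozengesIn_mem_tilings hd.symm (Finset.union_comm R₀ R₁ ▸ hT)
  · intro p hp
    refine Prod.ext ?_ ?_ <;> grind [Finset.disjoint_left]
  · intro T hT
    obtain ⟨hT, hTC⟩ := Finset.mem_filter.1 hT
    rw [← hTC]
    exact union_crossingLozenges (subset_lozengesIn_of_mem_tilings hT)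
  · intro p hp
    obtain ⟨h₀, h₁⟩ := hsub p hp
    rw [Finset.prod_union (Finset.disjoint_union_right.2
      ⟨hdX₀.mono hC h₀, hdX₁.mono hC h₁⟩), Finset.prod_union (hd₀₁.mono h₀ h₁)]

theorem tilingSum_union (w : UnitTriangle × UnitTriangle → M) (hd : Disjoint R₀ R₁)
    (hX : (crossingLozenges R₀ R₁ : Set (UnitTriangle × UnitTriangle)).PairwiseDisjoint
      lozengeTriangles) :
    tilingSum w (R₀ ∪ R₁) = ∑ C ∈ (crossingLozenges R₀ R₁).powerset,
      (∏ l ∈ C, w l) * (tilingSum w (R₀ \ C.biUnion lozengeTriangles) *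
        tilingSum w (R₁ \ C.biUnion lozengeTriangles)) := by
  rw [tilingSum, ← Finset.sum_fiberwise_of_maps_to (g := (· ∩ crossingLozenges R₀ R₁))
    fun T _ => Finset.mem_powerset.2 Finset.inter_subset_right]
  refine Finset.sum_congr rfl fun C hC => ?_
  have hC := Finset.mem_powerset.1 hC
  refine sum_tilings_with_crossing w hd hC (mem_tilings.2 ⟨fun l hl => ?_, ?_, rfl⟩)
  · exact (mem_lozengesIn.1 (Finset.mem_sdiff.1 (hC hl)).1).1
  · exact hX.subset (Finset.coe_subset.2 hC)

end Tilings

section Rows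

/-- The weight for which a vertical lozenge whose center has abscissa `i` weighs `v i` and all other
lozenges weigh `1`: `symmetricWeight` with an arbitrary function of the abscissa. -/
def verticalWeight {M : Type*} [One M] (v : ℤ → M) (l : UnitTriangle × UnitTriangle) : M :=
  if l.2 = (l.1.1, l.1.2 - 1) then v l.1.1 else 1

/-- The vertical lozenge with center `(i, j + 1)`, provided that `i + j` is even. -/
def verticalLozenge (j i : ℤ) : UnitTriangle × UnitTriangle := ((i, j + 1), (i, j))

/-- The lozenge formed by the neighbouring unit triangles `(i - 1, j)` and `(i, j)`, the up-pointing
one of which has to come first. -/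
def horizontalLozenge (j i : ℤ) : UnitTriangle × UnitTriangle :=
  if Odd (i + j) then ((i, j), (i - 1, j)) else ((i - 1, j), (i, j))

/-- The unit triangles between the heights `j` and `j + 1` with abscissae in `S`. -/
def rowTriangles (j : ℤ) (S : Finset ℤ) : Finset UnitTriangle := S ×ˢ {j}

/-- The number of even minus the number of odd elements of `S` below `t`. -/
def parityExcess (S : Finset ℤ) (t : ℤ) : ℤ := ∑ u ∈ S with u < t, (u.negOnePow : ℤ)

/-- The condition for `S` to split into pairs of consecutive integers. -/
def IsBalanced (S : Finset ℤ) : Prop := ∀ t ∉ S, parityExcess S t = 0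

variable {M : Type*} [CommSemiring M] {v : ℤ → M} {j k : ℤ} {S B : Finset ℤ}
  {R : Finset UnitTriangle} {t : UnitTriangle} {l : UnitTriangle × UnitTriangle}

theorem mem_rowTriangles : t ∈ rowTriangles j S ↔ t.1 ∈ S ∧ t.2 = j := by
  rw [rowTriangles, Finset.mem_product, Finset.mem_singleton]

theorem rowTriangles_sdiff : rowTriangles j S \ rowTriangles j B = rowTriangles j (S \ B) := by
  ext t
  simp only [Finset.mem_sdiff, mem_rowTriangles]
  tauto

theorem verticalWeight_verticalLozenge (i : ℤ) : verticalWeight v (verticalLozenge j i) = v i := by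
  simp [verticalWeight, verticalLozenge]

theorem verticalWeight_horizontalLozenge (i : ℤ) :
    verticalWeight v (horizontalLozenge j i) = 1 := by
  unfold horizontalLozenge
  split_ifs <;> exact if_neg (by simp only [Prod.mk.injEq]; lia)

theorem lozengeTriangles_horizontalLozenge (i : ℤ) :
    lozengeTriangles (horizontalLozenge j i) = rowTriangles j {i - 1, i} := by
  ext ⟨a, b⟩
  unfold horizontalLozenge
  split_ifs <;> simp only [mem_lozengeTriangles, mem_rowTriangles, Finset.mem_insert,
    Finset.mem_singleton, Prod.mk.injEq] <;> tauto

theorem parityExcess_add_one (S : Finset ℤ) (t : ℤ) :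
    parityExcess S (t + 1) = parityExcess S t + if t ∈ S then (t.negOnePow : ℤ) else 0 := by
  rw [parityExcess, parityExcess]
  split_ifs with ht
  · rw [show {u ∈ S | u < t + 1} = insert t {u ∈ S | u < t} by grind,
      Finset.sum_insert (by simp), add_comm]
  · rw [show {u ∈ S | u < t + 1} = {u ∈ S | u < t} by grind, add_zero]

theorem parityExcess_sdiff_add (h : B ⊆ S) (t : ℤ) :
    parityExcess (S \ B) t + parityExcess B t = parityExcess S t := by
  simp only [parityExcess, Finset.sum_filter]
  exact Finset.sum_sdiff h

theorem parityExcess_pair {t : ℤ} (ht : t ≠ k) : parityExcess {k - 1, k} t = 0 := by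
  rw [parityExcess, Finset.sum_filter, Finset.sum_pair (by lia), Int.negOnePow_sub]
  split_ifs <;> first | lia | simp

theorem not_isBalanced_of_isolated (hk : k ∈ S) (hpred : k - 1 ∉ S) (hsucc : k + 1 ∉ S) :
    ¬ IsBalanced S := by
  intro h
  have hdiff := parityExcess_add_one S (k - 1)
  rw [sub_add_cancel, h _ hpred, if_neg hpred] at hdiff
  have := parityExcess_add_one S k
  rw [h _ hsucc, hdiff, if_pos hk] at this
  exact k.negOnePow.ne_zero (by simpa using this.symm)

theorem isBalanced_sdiff_pair (hk : k ∈ S) (hpred : k - 1 ∈ S) (hsucc : k + 1 ∉ S) :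
    IsBalanced (S \ {k - 1, k}) ↔ IsBalanced S := by
  have hne : ∀ t ≠ k, parityExcess (S \ {k - 1, k}) t = parityExcess S t := fun t ht => by
    rw [← parityExcess_sdiff_add (S := S) (B := {k - 1, k}) (by grind), parityExcess_pair ht,
      add_zero]
  have hpred' := parityExcess_add_one (S \ {k - 1, k}) (k - 1)
  have hk' := parityExcess_add_one (S \ {k - 1, k}) k
  rw [if_neg (by simp)] at hpred' hk'
  rw [sub_add_cancel, add_zero] at hpred'
  rw [add_zero, hne _ (by lia)] at hk'
  refine ⟨fun h t ht => ?_, fun h t ht => ?_⟩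
  · rw [← hne t (by grind)]
    exact h t (by grind)
  · by_cases htS : t ∈ S
    · have : t = k - 1 ∨ t = k := by grind
      rcases this with rfl | rfl
      · rw [← hpred', ← hk', h _ hsucc]
      · rw [← hk', h _ hsucc]
    · rw [hne t (by grind), h t htS]

theorem lozengesIn_rowTriangles_through (hk : k ∈ S) (hsucc : k + 1 ∉ S) :
    {l ∈ lozengesIn (rowTriangles j S) | (k, j) ∈ lozengeTriangles l} =
      if k - 1 ∈ S then {horizontalLozenge j k} else ∅ := by
  ext ⟨⟨a, b⟩, c, d⟩
  unfold horizontalLozenge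
  simp only [Finset.mem_filter, lozengesIn, Finset.mem_product, mem_rowTriangles, IsLozenge,
    UnitTriangle.IsUp, mem_lozengeTriangles]
  grind

theorem tilingSum_rowTriangles [DecidablePred IsBalanced] (j : ℤ) (S : Finset ℤ) :
    tilingSum (verticalWeight v) (rowTriangles j S) = if IsBalanced S then 1 else 0 := by
  induction S using Finset.strongInduction with
  | H S ih =>
    rcases S.eq_empty_or_nonempty with rfl | hS
    · simp [rowTriangles, tilingSum_empty, IsBalanced, parityExcess]
    have hk := S.max'_mem hS
    have hsucc : S.max' hS + 1 ∉ S := fun h => by have := S.le_max' _ h; lia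
    generalize S.max' hS = k at hk hsucc
    rw [tilingSum_eq_sum_lozenges_through (t := (k, j)) _ (mem_rowTriangles.2 ⟨hk, rfl⟩),
      lozengesIn_rowTriangles_through hk hsucc]
    by_cases hpred : k - 1 ∈ S
    · have hlt : S \ {k - 1, k} ⊂ S := Finset.sdiff_ssubset (by grind) (by simp)
      rw [if_pos hpred, Finset.sum_singleton, verticalWeight_horizontalLozenge, one_mul,
        lozengeTriangles_horizontalLozenge, rowTriangles_sdiff, ih _ hlt]
      simp only [isBalanced_sdiff_pair hk hpred hsucc]
    · rw [if_neg hpred, if_neg (not_isBalanced_of_isolated hk hpred hsucc), Finset.sum_empty]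

theorem verticalLozenge_injective (j : ℤ) : Function.Injective (verticalLozenge j) :=
  fun _ _ h => congrArg (fun l => l.1.1) h

theorem crossingLozenges_rowTriangles (hR : ∀ t ∈ R, j < t.2) :
    crossingLozenges (rowTriangles j S) R =
      {b ∈ S | Even (b + j) ∧ (b, j + 1) ∈ R}.image (verticalLozenge j) := by
  ext ⟨⟨a, b⟩, c, d⟩
  simp only [crossingLozenges, lozengesIn, verticalLozenge, Finset.mem_sdiff, Finset.mem_filter,
    Finset.mem_product, Finset.mem_union, mem_rowTriangles, IsLozenge, UnitTriangle.IsUp,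
    Finset.mem_image, Prod.mk.injEq]
  grind

theorem biUnion_image_verticalLozenge (B : Finset ℤ) :
    (B.image (verticalLozenge j)).biUnion lozengeTriangles =
      rowTriangles j B ∪ rowTriangles (j + 1) B := by
  ext ⟨a, b⟩
  simp only [Finset.mem_biUnion, Finset.mem_image, mem_lozengeTriangles, Finset.mem_union,
    mem_rowTriangles, verticalLozenge]
  grind

theorem pairwiseDisjoint_image_verticalLozenge (B : Finset ℤ) :
    (B.image (verticalLozenge j) : Set (UnitTriangle × UnitTriangle)).PairwiseDisjoint
      lozengeTriangles := by
  intro l hl l' hl' hne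
  obtain ⟨b, -, rfl⟩ := Finset.mem_image.1 hl
  obtain ⟨b', -, rfl⟩ := Finset.mem_image.1 hl'
  refine Finset.disjoint_left.2 fun t ht ht' => hne ?_
  simp only [mem_lozengeTriangles, verticalLozenge] at ht ht'
  grind [verticalLozenge]

theorem tilingSum_rowTriangles_union (hR : ∀ t ∈ R, j < t.2) :
    tilingSum (verticalWeight v) (rowTriangles j S ∪ R) =
      ∑ B ∈ {b ∈ S | Even (b + j) ∧ (b, j + 1) ∈ R}.powerset, (∏ b ∈ B, v b) *
        (tilingSum (verticalWeight v) (rowTriangles j (S \ B)) *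
          tilingSum (verticalWeight v) (R \ rowTriangles (j + 1) B)) := by
  have hdisj : Disjoint (rowTriangles j S) R := Finset.disjoint_left.2 fun t ht htR =>
    (hR t htR).ne' (mem_rowTriangles.1 ht).2
  have hrow : ∀ B : Finset ℤ, Disjoint R (rowTriangles j B) := fun B =>
    Finset.disjoint_left.2 fun t htR ht => (hR t htR).ne' (mem_rowTriangles.1 ht).2
  have hnext : ∀ A B : Finset ℤ, Disjoint (rowTriangles j A) (rowTriangles (j + 1) B) := fun A B =>
    Finset.disjoint_left.2 fun t ht ht' => by grind [mem_rowTriangles]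
  rw [tilingSum_union _ hdisj, crossingLozenges_rowTriangles hR, Finset.powerset_image,
    Finset.sum_image (Finset.image_injective (verticalLozenge_injective j)).injOn]
  · refine Finset.sum_congr rfl fun B _ => ?_
    rw [Finset.prod_image (verticalLozenge_injective j).injOn, biUnion_image_verticalLozenge,
      ← Finset.sup_eq_union, ← sdiff_sdiff_left, ← sdiff_sdiff_left, rowTriangles_sdiff,
      (hrow B).sdiff_eq_left, (hnext _ B).sdiff_eq_left]
    simp only [verticalWeight_verticalLozenge]
  · rw [crossingLozenges_rowTriangles hR]
    exact pairwiseDisjoint_image_verticalLozenge _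

end Rows

section Interlacing

/-- The sequences `r` that interlace with `a`, in the sense that `a i < r i < a (i + 1)`, and whose
terms have the opposite parity to those of `a`. -/
noncomputable def interlacing {m : ℕ} (a : Fin (m + 1) → ℤ) : Finset (Fin m → ℤ) :=
  Fintype.piFinset fun i => {b ∈ Finset.Ioo (a i.castSucc) (a i.succ) | Odd (b - a i.castSucc)}

variable {m : ℕ} {a : Fin (m + 1) → ℤ} {r : Fin m → ℤ} {A B : Finset ℤ} {lo hi t : ℤ}

theorem mem_interlacing : r ∈ interlacing a ↔
    ∀ i, (a i.castSucc < r i ∧ r i < a i.succ) ∧ Odd (r i - a i.castSucc) := by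
  simp only [interlacing, Fintype.mem_piFinset, Finset.mem_filter, Finset.mem_Ioo]

theorem strictMono_of_interlacing (h : r ∈ interlacing a) : StrictMono a :=
  Fin.strictMono_iff_lt_succ.2 fun i =>
    (mem_interlacing.1 h i).1.1.trans (mem_interlacing.1 h i).1.2

theorem interlacing_lt_iff (h : r ∈ interlacing a) (k : Fin m) (i : Fin (m + 1)) :
    r k < a i ↔ (k : ℕ) < i := by
  have ha := (strictMono_of_interlacing h).monotone
  obtain ⟨hlt, hgt⟩ := (mem_interlacing.1 h k).1
  constructor
  · intro hki
    by_contra! hik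
    exact (hlt.trans hki).not_ge (ha (show i ≤ k.castSucc from hik))
  · intro hki
    exact hgt.trans_le (ha (show k.succ ≤ i from hki))

theorem lt_interlacing_iff (h : r ∈ interlacing a) (k : Fin m) (i : Fin (m + 1)) :
    a i < r k ↔ (i : ℕ) < k + 1 := by
  have ha := (strictMono_of_interlacing h).monotone
  obtain ⟨hlt, hgt⟩ := (mem_interlacing.1 h k).1
  constructor
  · intro hik
    by_contra! hki
    exact (hik.trans hgt).not_ge (ha (show k.succ ≤ i from hki))
  · intro hik
    exact (ha (show i ≤ k.castSucc from Nat.lt_succ_iff.1 hik)).trans_lt hlt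

theorem strictMono_interlacing (h : r ∈ interlacing a) : StrictMono r := fun k l hkl =>
  ((interlacing_lt_iff h k l.castSucc).2 hkl).trans (mem_interlacing.1 h l).1.1

theorem card_filter_lt_image {f : Fin m → ℤ} (hf : Function.Injective f) (t : ℤ) :
    Finset.card {b ∈ Finset.univ.image f | b < t} = Finset.card {i | f i < t} := by
  rw [Finset.filter_image, Finset.card_image_of_injective _ hf]

theorem parityExcess_Icc (h : lo ≤ t) (h' : t ≤ hi + 1) :
    parityExcess (Finset.Icc lo hi) t = lo.negOnePow * if Odd (t - lo) then 1 else 0 := by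
  induction t, h using Int.leInduction with
  | base =>
    rw [parityExcess, show {u ∈ Finset.Icc lo hi | u < lo} = ∅ by grind]
    simp
  | succ t hlt ih =>
    rw [parityExcess_add_one, ih (by lia), if_pos (Finset.mem_Icc.2 ⟨hlt, by lia⟩),
      show t.negOnePow = lo.negOnePow * (t - lo).negOnePow by
        rw [← Int.negOnePow_add, add_sub_cancel]]
    rcases Int.even_or_odd (t - lo) with ht | ht
    · rw [Int.negOnePow_even _ ht, if_neg (by grind), if_pos (by grind)]
      simp
    · rw [Int.negOnePow_odd _ ht, if_pos ht, if_neg (by grind)]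
      simp

theorem parityExcess_of_forall_even_sub (hA : ∀ u ∈ A, Even (u - lo)) (t : ℤ) :
    parityExcess A t = lo.negOnePow * Finset.card {u ∈ A | u < t} := by
  rw [parityExcess, Finset.sum_congr rfl fun u hu => congrArg Units.val
    ((Int.negOnePow_eq_iff u lo).2 (hA u (Finset.mem_filter.1 hu).1)), Finset.sum_const,
    nsmul_eq_mul, mul_comm]

theorem parityExcess_Icc_sdiff_sdiff (hA : ∀ u ∈ A, (lo ≤ u ∧ u ≤ hi) ∧ Even (u - lo))
    (hB : ∀ u ∈ B, (lo ≤ u ∧ u ≤ hi) ∧ Odd (u - lo)) (h : lo ≤ t) (h' : t ≤ hi + 1) :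
    parityExcess ((Finset.Icc lo hi \ A) \ B) t = lo.negOnePow *
      ((if Odd (t - lo) then 1 else 0) - Finset.card {u ∈ A | u < t} +
        Finset.card {u ∈ B | u < t}) := by
  have hBA : B ⊆ Finset.Icc lo hi \ A := fun u hu => Finset.mem_sdiff.2
    ⟨Finset.mem_Icc.2 (hB u hu).1, fun huA => by grind⟩
  have hAI : A ⊆ Finset.Icc lo hi := fun u hu => Finset.mem_Icc.2 (hA u hu).1
  have h₁ := parityExcess_sdiff_add hBA t
  have h₂ := parityExcess_sdiff_add hAI t
  rw [parityExcess_Icc h h', parityExcess_of_forall_even_sub fun u hu => (hA u hu).2] at h₂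
  rw [parityExcess_of_forall_even_sub (A := B) (lo := lo + 1) fun u hu => by grind,
    Int.negOnePow_succ, Units.val_neg] at h₁
  linear_combination h₁ + h₂

theorem isBalanced_Icc_sdiff_sdiff_iff (hlohi : Even (hi - lo)) (hlt : lo ≤ hi)
    (hA : ∀ u ∈ A, (lo ≤ u ∧ u ≤ hi) ∧ Even (u - lo))
    (hB : ∀ u ∈ B, (lo ≤ u ∧ u ≤ hi) ∧ Odd (u - lo)) :
    IsBalanced ((Finset.Icc lo hi \ A) \ B) ↔
      (∀ t ∈ A, Finset.card {u ∈ B | u < t} = Finset.card {u ∈ A | u < t}) ∧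
      (∀ t ∈ B, Finset.card {u ∈ A | u < t} = Finset.card {u ∈ B | u < t} + 1) ∧
      A.card = B.card + 1 := by
  have hexcess {t : ℤ} (h : lo ≤ t) (h' : t ≤ hi + 1) :
      parityExcess ((Finset.Icc lo hi \ A) \ B) t = 0 ↔ (if Odd (t - lo) then 1 else 0) -
        (Finset.card {u ∈ A | u < t} : ℤ) + Finset.card {u ∈ B | u < t} = 0 := by
    rw [parityExcess_Icc_sdiff_sdiff hA hB h h', mul_eq_zero_iff_left lo.negOnePow.ne_zero]
  have hall (C : Finset ℤ) (hC : ∀ u ∈ C, u ≤ hi) : {u ∈ C | u < hi + 1} = C :=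
    Finset.filter_true_of_mem fun u hu => Int.lt_add_one_iff.2 (hC u hu)
  have hlast : parityExcess ((Finset.Icc lo hi \ A) \ B) (hi + 1) = 0 ↔ A.card = B.card + 1 := by
    rw [hexcess (by lia) le_rfl, hall A fun u hu => (hA u hu).1.2,
      hall B fun u hu => (hB u hu).1.2, if_pos (by grind)]
    lia
  rw [← hlast]
  constructor
  · intro h
    refine ⟨fun t ht => ?_, fun t ht => ?_, h _ (by grind)⟩
    · have := (hexcess (hA t ht).1.1 (by grind)).1 (h t (by grind))
      rw [if_neg (by grind)] at this
      lia
    · have := (hexcess (hB t ht).1.1 (by grind)).1 (h t (by grind))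
      rw [if_pos (hB t ht).2] at this
      lia
  · rintro ⟨h₁, h₂, h₃⟩ t ht
    rcases lt_or_ge t lo with hlo | hlo
    · rw [parityExcess, Finset.filter_false_of_mem (by grind), Finset.sum_empty]
    rcases lt_or_ge hi t with hhi | hhi
    · rw [← h₃, parityExcess, parityExcess]
      exact congrArg (Finset.sum · _) (Finset.filter_congr (by grind))
    rw [hexcess hlo (by lia)]
    by_cases htA : t ∈ A
    · rw [if_neg (by grind), h₁ t htA]
      lia
    · have htB : t ∈ B := by grind
      rw [if_pos (hB t htB).2, h₂ t htB]
      lia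

theorem isBalanced_Icc_sdiff_image_iff (hlohi : Even (hi - lo)) (hlt : lo ≤ hi)
    (ha : StrictMono a) (haI : ∀ i, (lo ≤ a i ∧ a i ≤ hi) ∧ Even (a i - lo))
    (hB : ∀ u ∈ B, (lo ≤ u ∧ u ≤ hi) ∧ Odd (u - lo)) :
    IsBalanced ((Finset.Icc lo hi \ Finset.univ.image a) \ B) ↔
      ∃ r ∈ interlacing a, Finset.univ.image r = B := by
  rw [isBalanced_Icc_sdiff_sdiff_iff hlohi hlt
    (Finset.forall_mem_image.2 fun i _ => haI i) hB]
  constructor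
  · rintro ⟨-, h, hcard⟩
    rw [Finset.card_image_of_injective _ ha.injective, Finset.card_fin, Nat.add_right_cancel_iff,
      eq_comm] at hcard
    obtain ⟨r, hr, rfl⟩ : ∃ r : Fin m → ℤ, StrictMono r ∧ Finset.univ.image r = B :=
      ⟨_, (B.orderEmbOfFin hcard).strictMono, B.image_orderEmbOfFin_univ hcard⟩
    refine ⟨r, mem_interlacing.2 fun k => ?_, rfl⟩
    have hk := Finset.mem_image_of_mem r (Finset.mem_univ k)
    have hcount : Finset.card {i | a i < r k} = k + 1 := by
      have := h _ hk
      simpa only [card_filter_lt_image ha.injective, card_filter_lt_image hr.injective,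
        hr.lt_iff_lt, Finset.filter_gt_eq_Iio, Fin.card_Iio] using this
    have hlt := Tuple.lt_card_lt_iff_apply_lt_of_monotone (j := k.castSucc) (a := r k) ha.monotone
    have hgt := Tuple.lt_card_lt_iff_apply_lt_of_monotone (j := k.succ) (a := r k) ha.monotone
    rw [hcount] at hlt hgt
    have : a k.succ ≠ r k := by grind
    have := hlt.1 (by simp)
    have := mt hgt.2 (by simp)
    grind
  · rintro ⟨r, hr, rfl⟩
    have hrm := strictMono_interlacing hr
    refine ⟨Finset.forall_mem_image.2 fun i _ => ?_, Finset.forall_mem_image.2 fun k _ => ?_, ?_⟩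
    · simp only [card_filter_lt_image ha.injective, card_filter_lt_image hrm.injective,
        ha.lt_iff_lt, interlacing_lt_iff hr, Finset.filter_gt_eq_Iio, Fin.card_Iio,
        Fin.card_filter_val_lt]
      lia
    · simp only [card_filter_lt_image ha.injective, card_filter_lt_image hrm.injective,
        hrm.lt_iff_lt, lt_interlacing_iff hr, Finset.filter_gt_eq_Iio, Fin.card_Iio,
        Fin.card_filter_val_lt]
      lia
    · rw [Finset.card_image_of_injective _ ha.injective,
        Finset.card_image_of_injective _ hrm.injective, Finset.card_fin, Finset.card_fin]

theorem image_injOn_interlacing :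
    Set.InjOn (fun r : Fin m → ℤ => Finset.univ.image r) (interlacing a) := by
  intro r hr r' hr' h
  refine ((strictMono_interlacing hr).range_inj (strictMono_interlacing hr')).1 ?_
  simpa using congrArg (fun s : Finset ℤ => (s : Set ℤ)) h

end Interlacing

section DentedTrapezoid

/-- The rows of heights `j ≤ t < H` between the vertical zigzag and the lattice line
`i + t = L + 1`, without the unit triangles of row `j` with abscissae in `A`. For odd `L` this is a
`trapezoid` whose base is at height `j` and has dents at `A`. -/
noncomputable def dentedTrapezoid (L H j : ℤ) (A : Finset ℤ) : Finset UnitTriangle :=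
  {t ∈ Finset.Icc 1 (L - j) ×ˢ Finset.Ico j H | t.1 + t.2 ≤ L} \ rowTriangles j A

variable {M : Type*} [CommSemiring M] {v : ℤ → M} {m : ℕ} {a : Fin (m + 1) → ℤ} {L H j lo : ℤ}
  {A B : Finset ℤ}

theorem mem_dentedTrapezoid {t : UnitTriangle} : t ∈ dentedTrapezoid L H j A ↔
    (1 ≤ t.1 ∧ t.1 + t.2 ≤ L) ∧ (j ≤ t.2 ∧ t.2 < H) ∧ ¬ (t.1 ∈ A ∧ t.2 = j) := by
  simp only [dentedTrapezoid, Finset.mem_sdiff, Finset.mem_filter, Finset.mem_product,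
    Finset.mem_Icc, Finset.mem_Ico, mem_rowTriangles]
  grind

theorem dentedTrapezoid_eq_empty (h : H ≤ j) : dentedTrapezoid L H j A = ∅ := by
  ext t
  grind [mem_dentedTrapezoid]

theorem dentedTrapezoid_insert_zero :
    dentedTrapezoid L H j (insert 0 A) = dentedTrapezoid L H j A := by
  ext t
  grind [mem_dentedTrapezoid]

theorem dentedTrapezoid_empty_sdiff :
    dentedTrapezoid L H j ∅ \ rowTriangles j B = dentedTrapezoid L H j B := by
  ext t
  grind [mem_dentedTrapezoid, mem_rowTriangles]

theorem dentedTrapezoid_eq_union (hjH : j < H) (hlo : lo ≤ 1) (hA : Finset.Ico lo 1 ⊆ A) :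
    dentedTrapezoid L H j A =
      rowTriangles j (Finset.Icc lo (L - j) \ A) ∪ dentedTrapezoid L H (j + 1) ∅ := by
  have : ∀ b, lo ≤ b → b < 1 → b ∈ A := fun b h h' => hA (Finset.mem_Ico.2 ⟨h, h'⟩)
  ext t
  simp only [Finset.mem_union, mem_rowTriangles, mem_dentedTrapezoid]
  grind

theorem filter_isBalanced_eq_image_interlacing [DecidablePred IsBalanced] (hjH : j + 1 < H)
    (hL : Odd L) (hlo : Odd (lo + j)) (hA : Finset.Ico lo 1 ⊆ Finset.univ.image a)
    (ha : StrictMono a) (haI : ∀ i, (lo ≤ a i ∧ a i ≤ L - j) ∧ Even (a i - lo)) :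
    {B ∈ {b ∈ Finset.Icc lo (L - j) \ Finset.univ.image a |
        Even (b + j) ∧ (b, j + 1) ∈ dentedTrapezoid L H (j + 1) ∅}.powerset |
      IsBalanced ((Finset.Icc lo (L - j) \ Finset.univ.image a) \ B)} =
    (interlacing a).image fun r => Finset.univ.image r := by
  have hlt : lo ≤ L - j := (haI 0).1.1.trans (haI 0).1.2
  have hout : ∀ b, lo ≤ b → b < 1 → b ∈ Finset.univ.image a := fun b h h' =>
    hA (Finset.mem_Ico.2 ⟨h, h'⟩)
  ext B
  simp only [Finset.mem_filter, Finset.mem_powerset, Finset.mem_image (s := interlacing a)]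
  constructor
  · rintro ⟨hB, hbal⟩
    refine (isBalanced_Icc_sdiff_image_iff (by grind) hlt ha haI fun u hu => ?_).1 hbal
    have := Finset.mem_filter.1 (hB hu)
    grind
  · rintro ⟨r, hr, rfl⟩
    have hrI (k : Fin m) : (lo ≤ r k ∧ r k ≤ L - j) ∧ Odd (r k - lo) := by
      have := mem_interlacing.1 hr k
      have := haI k.castSucc
      have := haI k.succ
      grind
    refine ⟨Finset.image_subset_iff.2 fun k _ => ?_,
      (isBalanced_Icc_sdiff_image_iff (by grind) hlt ha haI
        (Finset.forall_mem_image.2 fun k _ => hrI k)).2 ⟨r, hr, rfl⟩⟩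
    have hne : r k ∉ Finset.univ.image a := by
      simp only [Finset.mem_image, not_exists, not_and]
      intro i _ hi
      have := hrI k
      have := haI i
      grind
    have := hrI k
    simp only [Finset.mem_filter, Finset.mem_sdiff, Finset.mem_Icc, mem_dentedTrapezoid]
    grind

theorem tilingSum_dentedTrapezoid (hjH : j + 1 < H) (hL : Odd L) (hlo : Odd (lo + j))
    (hlo₁ : lo ≤ 1) (hA : Finset.Ico lo 1 ⊆ Finset.univ.image a) (ha : StrictMono a)
    (haI : ∀ i, (lo ≤ a i ∧ a i ≤ L - j) ∧ Even (a i - lo)) :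
    tilingSum (verticalWeight v) (dentedTrapezoid L H j (Finset.univ.image a)) =
      ∑ r ∈ interlacing a, (∏ i, v (r i)) *
        tilingSum (verticalWeight v) (dentedTrapezoid L H (j + 1) (Finset.univ.image r)) := by
  classical
  rw [dentedTrapezoid_eq_union (by lia) hlo₁ hA,
    tilingSum_rowTriangles_union fun t ht => by grind [mem_dentedTrapezoid]]
  simp only [tilingSum_rowTriangles, dentedTrapezoid_empty_sdiff, ite_mul, one_mul, zero_mul,
    mul_ite, mul_zero]
  rw [← Finset.sum_filter, filter_isBalanced_eq_image_interlacing hjH hL hlo hA ha haI,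
    Finset.sum_image image_injOn_interlacing]
  refine Finset.sum_congr rfl fun r hr => ?_
  rw [Finset.prod_image (strictMono_interlacing hr).injective.injOn]

theorem tilingSum_dentedTrapezoid_one_row {a : Fin 1 → ℤ} (hL : Odd L) (hj : Even j)
    (haI : (1 ≤ a 0 ∧ a 0 ≤ L - j) ∧ Odd (a 0)) :
    tilingSum (verticalWeight v) (dentedTrapezoid L (j + 1) j (Finset.univ.image a)) = 1 := by
  classical
  have hbal := (isBalanced_Icc_sdiff_image_iff (a := a) (B := ∅) (lo := 1) (hi := L - j)
    (by grind) (haI.1.1.trans haI.1.2) (Subsingleton.strictMono a)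
    (fun i => by fin_cases i; grind) (by simp)).2
    ⟨Fin.elim0, mem_interlacing.2 (fun i => i.elim0), rfl⟩
  rw [Finset.sdiff_empty] at hbal
  rw [dentedTrapezoid_eq_union (lo := 1) (by lia) le_rfl (by simp),
    dentedTrapezoid_eq_empty le_rfl, Finset.union_empty, tilingSum_rowTriangles, if_pos hbal]

end DentedTrapezoid

section QNumber

variable {K : Type*} [Field K] {q : K}

open Classical in
/-- The symmetric `q`-number `[m] = (q^m - q^(-m)) / (q - q^(-1))`. At `q = q^(-1)`, where the
denominator vanishes, it is the value of the Laurent polynomial `q^(m-1) + q^(m-3) + ⋯ + q^(1-m)`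
for `m ≥ 0`, and odd in `m`. -/
noncomputable def qNumber (q : K) (m : ℤ) : K :=
  if q = q⁻¹ then m * q ^ (m - 1) else (q ^ m - q ^ (-m)) / (q - q⁻¹)

/-- The `q`-analogue of the hyperbolic cosine: the weight of a vertical lozenge whose center has
abscissa `t`. -/
def qCosh (q : K) (t : ℤ) : K := (q ^ t + q ^ (-t)) / 2

theorem zpow_neg_of_eq_inv (h : q = q⁻¹) (m : ℤ) : q ^ (-m) = q ^ m := by
  conv_rhs => rw [h, inv_zpow']

theorem qNumber_zero (q : K) : qNumber q 0 = 0 := by simp [qNumber]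

theorem qNumber_one (q : K) : qNumber q 1 = 1 := by
  rw [qNumber]
  split_ifs with h
  · simp
  · simpa using div_self (sub_ne_zero.2 h)

theorem qNumber_mul_sub_inv (q : K) (m : ℤ) : qNumber q m * (q - q⁻¹) = q ^ m - q ^ (-m) := by
  rw [qNumber]
  split_ifs with h
  · rw [zpow_neg_of_eq_inv h, ← h, sub_self, sub_self, mul_zero]
  · exact div_mul_cancel₀ _ (sub_ne_zero.2 h)

theorem qNumber_add (hq : q ≠ 0) (m n : ℤ) :
    qNumber q (m + n) = q ^ m * qNumber q n + q ^ (-n) * qNumber q m := by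
  simp only [qNumber]
  split_ifs with h
  · rw [zpow_neg_of_eq_inv h, zpow_sub₀ hq, zpow_sub₀ hq, zpow_sub₀ hq, zpow_add₀ hq]
    push_cast
    ring
  · rw [mul_div_assoc', mul_div_assoc', ← add_div, neg_add, zpow_add₀ hq, zpow_add₀ hq]
    ring

theorem qNumber_neg (hq : q ≠ 0) (m : ℤ) : qNumber q (-m) = -qNumber q m := by
  have h := qNumber_add hq m (-m)
  rw [add_neg_cancel, qNumber_zero, neg_neg, ← mul_add] at h
  linear_combination (mul_eq_zero_iff_left (zpow_ne_zero m hq)).1 h.symm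

theorem qNumber_add_sub_qNumber_sub (hq : q ≠ 0) (r a : ℤ) :
    qNumber q (r + a) - qNumber q (r - a) = qNumber q a * (q ^ r + q ^ (-r)) := by
  rw [qNumber_add hq, ← neg_add_eq_sub a r, qNumber_add hq, qNumber_neg hq]
  ring

theorem qNumber_add_mul_qNumber_sub (hq : q ≠ 0) (r a : ℤ) :
    qNumber q (r + a) * qNumber q (r - a) = qNumber q r ^ 2 - qNumber q a ^ 2 := by
  have hr : q ^ r * q ^ (-r) = 1 := by rw [← zpow_add₀ hq, add_neg_cancel, zpow_zero]
  have ha : q ^ a * q ^ (-a) = 1 := by rw [← zpow_add₀ hq, add_neg_cancel, zpow_zero]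
  rw [qNumber_add hq, sub_eq_add_neg, qNumber_add hq, qNumber_neg hq, neg_neg]
  linear_combination qNumber q r ^ 2 * ha - qNumber q a ^ 2 * hr
    - qNumber q r * qNumber q a * q ^ r * qNumber_mul_sub_inv q a
    + qNumber q a ^ 2 * q ^ r * qNumber_mul_sub_inv q r

theorem qNumber_natCast (hq : q ≠ 0) (m : ℕ) :
    qNumber q m = q ^ (1 - (m : ℤ)) * qInt (q ^ 2) m := by
  induction m with
  | zero => simp [qInt, qNumber_zero]
  | succ m ih =>
    have hpow : q ^ (m : ℤ) = q ^ (-(m : ℤ)) * (q ^ 2) ^ m := by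
      rw [← pow_mul, ← zpow_natCast q (2 * m), ← zpow_add₀ hq]
      congr 1
      lia
    have hexp : q ^ (-1 : ℤ) * q ^ (1 - (m : ℤ)) = q ^ (-(m : ℤ)) := by
      rw [← zpow_add₀ hq]
      congr 1
      ring
    have hsucc : qInt (q ^ 2) (m + 1) = qInt (q ^ 2) m + (q ^ 2) ^ m := Finset.sum_range_succ _ _
    rw [Nat.cast_succ, qNumber_add hq, qNumber_one, ih, hsucc, sub_add_cancel_right, hpow]
    linear_combination qInt (q ^ 2) m * hexp

/-- The `q`-analogue of the central factorial: the product of the `k` symmetric `q`-numbers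
`[t - k + 1] [t - k + 3] ⋯ [t + k - 1]`. -/
noncomputable def qCentralFactorial (q : K) (k : ℕ) (t : ℤ) : K :=
  ∏ l ∈ Finset.range k, qNumber q (t + 1 - k + 2 * l)

theorem qCentralFactorial_succ_add_one (q : K) (k : ℕ) (t : ℤ) :
    qCentralFactorial q (k + 1) (t + 1) = qCentralFactorial q k t * qNumber q (t + (k + 1)) := by
  rw [qCentralFactorial, Finset.prod_range_succ, qCentralFactorial]
  congr 1
  · exact Finset.prod_congr rfl fun l _ => congrArg _ (by push_cast; ring)
  · exact congrArg _ (by push_cast; ring)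

theorem qCentralFactorial_succ_sub_one (q : K) (k : ℕ) (t : ℤ) :
    qCentralFactorial q (k + 1) (t - 1) = qCentralFactorial q k t * qNumber q (t - (k + 1)) := by
  rw [qCentralFactorial, Finset.prod_range_succ', qCentralFactorial]
  congr 1
  · exact Finset.prod_congr rfl fun l _ => congrArg _ (by push_cast; ring)
  · exact congrArg _ (by push_cast; ring)

/-- The `q`-analogue of `δ t^[k + 1] = (k + 1) t^[k]` for the central difference `δ`. -/
theorem qCentralFactorial_add_one_sub_sub_one (hq : q ≠ 0) (h2 : (2 : K) ≠ 0) (k : ℕ) (t : ℤ) :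
    qCentralFactorial q (k + 1) (t + 1) - qCentralFactorial q (k + 1) (t - 1) =
      2 * qNumber q (k + 1) * (qCosh q t * qCentralFactorial q k t) := by
  rw [qCentralFactorial_succ_add_one, qCentralFactorial_succ_sub_one, ← mul_sub,
    qNumber_add_sub_qNumber_sub hq, qCosh]
  field_simp

theorem qCentralFactorial_zero (q : K) (t : ℤ) : qCentralFactorial q 0 t = 1 :=
  Finset.prod_range_zero _

theorem qCentralFactorial_one (q : K) (t : ℤ) : qCentralFactorial q 1 t = qNumber q t := by
  simp [qCentralFactorial]

theorem qCentralFactorial_add_two (hq : q ≠ 0) (k : ℕ) (t : ℤ) :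
    qCentralFactorial q (k + 2) t =
      qCentralFactorial q k t * (qNumber q t ^ 2 - qNumber q (k + 1) ^ 2) := by
  rw [← sub_add_cancel t 1, qCentralFactorial_succ_add_one, qCentralFactorial_succ_sub_one,
    ← qNumber_add_mul_qNumber_sub hq, sub_add_cancel, mul_assoc, mul_comm (qNumber q _)]
  push_cast
  rw [show t - 1 + ((k : ℤ) + 1 + 1) = t + (k + 1) by ring]

theorem qCentralFactorial_two_mul (hq : q ≠ 0) (k : ℕ) (t : ℤ) :
    qCentralFactorial q (2 * k) t =
      ∏ l ∈ Finset.range k, (qNumber q t ^ 2 - qNumber q (2 * l + 1) ^ 2) := by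
  induction k with
  | zero => rw [Finset.prod_range_zero, mul_zero, qCentralFactorial_zero]
  | succ k ih => rw [Finset.prod_range_succ, ← ih, mul_add_one, qCentralFactorial_add_two hq,
      Nat.cast_mul, Nat.cast_ofNat]

theorem qCentralFactorial_two_mul_add_one_zero (hq : q ≠ 0) (k : ℕ) :
    qCentralFactorial q (2 * k + 1) 0 = 0 := by
  induction k with
  | zero => rw [mul_zero, zero_add, qCentralFactorial_one, qNumber_zero]
  | succ k ih => rw [mul_add_one, add_right_comm, qCentralFactorial_add_two hq, ih, zero_mul]

end QNumber

section Determinants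

theorem sum_Ioo_odd_telescope {G : Type*} [AddCommGroup G] (F : ℤ → G) {a a' : ℤ} (h : a ≤ a')
    (hpar : Even (a' - a)) :
    ∑ b ∈ Finset.Ioo a a' with Odd (b - a), (F (b + 1) - F (b - 1)) = F a' - F a := by
  obtain ⟨n, rfl⟩ : ∃ n : ℕ, a' = a + 2 * n := by
    obtain ⟨u, hu⟩ := hpar
    exact ⟨u.toNat, by lia⟩
  have hodd : {b ∈ Finset.Ioo a (a + 2 * n) | Odd (b - a)} =
      (Finset.range n).image fun k : ℕ => a + 2 * k + 1 := by
    ext b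
    simp only [Finset.mem_filter, Finset.mem_Ioo, Finset.mem_image, Finset.mem_range]
    constructor
    · rintro ⟨hb, u, hu⟩
      exact ⟨u.toNat, by lia, by lia⟩
    · rintro ⟨k, hk, rfl⟩
      exact ⟨by lia, k, by lia⟩
  have hinj : Function.Injective fun k : ℕ => a + 2 * (k : ℤ) + 1 := fun k l hkl => by lia
  rw [hodd, Finset.sum_image hinj.injOn]
  convert Finset.sum_range_sub (fun k : ℕ => F (a + 2 * k)) n using 4 <;> lia

variable {R : Type*} [CommRing R] {m : ℕ}

theorem prod_mul_sum_interlacing_det {a : Fin (m + 1) → ℤ} (ha : Monotone a)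
    (hpar : ∀ i : Fin m, Even (a i.succ - a i.castSucc)) (w : ℤ → R) (g F : ℕ → ℤ → R) (c : ℕ → R)
    (hF : ∀ k t, F k (t + 1) - F k (t - 1) = c k * (w t * g k t)) :
    (∏ k ∈ Finset.range m, c k) * ∑ r ∈ interlacing a, (∏ i, w (r i)) *
        (Matrix.of fun i k : Fin m => g k (r i)).det =
      (Matrix.of fun i k : Fin m => F k (a i.succ) - F k (a i.castSucc)).det := by
  have hrow (r : Fin m → ℤ) : (∏ i, w (r i)) * (Matrix.of fun i k : Fin m => g k (r i)).det =
      (Matrix.detRowAlternating (R := R) (n := Fin m)).toMultilinearMap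
        fun i (k : Fin m) => w (r i) * g k (r i) :=
    (Matrix.det_mul_column _ _).symm
  simp only [hrow, interlacing]
  rw [← MultilinearMap.map_sum_finset _ fun _ b (k : Fin m) => w b * g k b,
    ← Fin.prod_univ_eq_prod_range]
  refine (Matrix.det_mul_row (fun k : Fin m => c k) _).symm.trans (congrArg Matrix.det ?_)
  ext i k
  rw [Matrix.of_apply, Matrix.of_apply, Finset.sum_apply, Finset.mul_sum,
    ← sum_Ioo_odd_telescope (F k) (ha Fin.castSucc_lt_succ.le) (hpar i)]
  exact Finset.sum_congr rfl fun b _ => (hF k b).symm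

theorem det_sub_castSucc_eq_det (F : ℕ → ℤ → R) (hF : ∀ t, F 0 t = 1) (a : Fin (m + 1) → ℤ) :
    (Matrix.of fun i k : Fin m => F (k + 1) (a i.succ) - F (k + 1) (a i.castSucc)).det =
      (Matrix.of fun i k : Fin (m + 1) => F k (a i)).det := by
  rw [Matrix.det_eq_of_forall_row_eq_smul_add_pred
    (A := Matrix.of fun i k : Fin (m + 1) => F k (a i))
    (B := Matrix.of (Fin.cons (fun k => F k (a 0))
      (fun i k => F k (a i.succ) - F k (a i.castSucc)))) (fun _ => 1) (fun _ => rfl)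
    (fun i k => by simp), Matrix.det_succ_column_zero, Fin.sum_univ_succ]
  simp only [Nat.succ_eq_add_one, Fin.coe_ofNat_eq_mod, Nat.zero_mod, pow_zero, Matrix.of_apply,
    Fin.cons_zero, hF, mul_one, Fin.succAbove_zero, one_mul, Fin.val_succ, Fin.cons_succ, sub_self,
    mul_zero, zero_mul, Finset.sum_const_zero, add_zero]
  rfl

theorem det_sub_castSucc_cons_zero_eq_det (F : ℕ → ℤ → R) (hF : ∀ k, F k 0 = 0) (r : Fin m → ℤ) :
    (Matrix.of fun i k : Fin m => F k ((Fin.cons 0 r : Fin (m + 1) → ℤ) i.succ) -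
        F k ((Fin.cons 0 r : Fin (m + 1) → ℤ) i.castSucc)).det =
      (Matrix.of fun i k : Fin m => F k (r i)).det := by
  refine (det_sub_castSucc_eq_det (fun k t => match k with | 0 => 1 | k + 1 => F k t)
    (fun _ => rfl) (Fin.cons 0 r : Fin (m + 1) → ℤ)).trans ?_
  rw [Matrix.det_succ_row_zero, Fin.sum_univ_succ]
  simp only [Nat.succ_eq_add_one, Fin.coe_ofNat_eq_mod, Nat.zero_mod, pow_zero, Matrix.of_apply,
    mul_one, Fin.succAbove_zero, one_mul, Fin.val_succ, Fin.cons_zero, hF, mul_zero, zero_mul,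
    Finset.sum_const_zero, add_zero]
  rfl

variable {K : Type*} [Field K] {q : K}

theorem sum_interlacing_det_qCentralFactorial_odd (hq : q ≠ 0) (h2 : (2 : K) ≠ 0)
    {a : Fin (m + 1) → ℤ} (ha : Monotone a)
    (hpar : ∀ i : Fin m, Even (a i.succ - a i.castSucc)) :
    (∏ k ∈ Finset.range m, 2 * qNumber q ((2 * k + 1 : ℕ) + 1)) *
        ∑ r ∈ interlacing a, (∏ i, qCosh q (r i)) *
          (Matrix.of fun i k : Fin m => qCentralFactorial q (2 * k + 1) (r i)).det =
      (Matrix.of fun i k : Fin (m + 1) => qCentralFactorial q (2 * k) (a i)).det := by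
  rw [← det_sub_castSucc_eq_det (fun k => qCentralFactorial q (2 * k))
    (fun t => qCentralFactorial_zero q t)]
  exact prod_mul_sum_interlacing_det ha hpar (qCosh q) (fun k => qCentralFactorial q (2 * k + 1))
    (fun k => qCentralFactorial q (2 * (k + 1))) (fun k => 2 * qNumber q ((2 * k + 1 : ℕ) + 1))
    fun k t => qCentralFactorial_add_one_sub_sub_one hq h2 (2 * k + 1) t

theorem sum_interlacing_det_qCentralFactorial_even (hq : q ≠ 0) (h2 : (2 : K) ≠ 0)
    {r : Fin m → ℤ} (hr : Monotone (Fin.cons 0 r : Fin (m + 1) → ℤ)) (hpar : ∀ i, Even (r i)) :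
    (∏ k ∈ Finset.range m, 2 * qNumber q ((2 * k : ℕ) + 1)) *
        ∑ p ∈ interlacing (Fin.cons 0 r : Fin (m + 1) → ℤ), (∏ i, qCosh q (p i)) *
          (Matrix.of fun i k : Fin m => qCentralFactorial q (2 * k) (p i)).det =
      (Matrix.of fun i k : Fin m => qCentralFactorial q (2 * k + 1) (r i)).det := by
  have heven : ∀ i, Even ((Fin.cons 0 r : Fin (m + 1) → ℤ) i) :=
    Fin.cons (by simp) (by simpa using hpar)
  rw [← det_sub_castSucc_cons_zero_eq_det (fun k => qCentralFactorial q (2 * k + 1))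
    (qCentralFactorial_two_mul_add_one_zero hq)]
  exact prod_mul_sum_interlacing_det hr (fun i => (heven _).sub (heven _)) (qCosh q)
    (fun k => qCentralFactorial q (2 * k)) (fun k => qCentralFactorial q (2 * k + 1))
    (fun k => 2 * qNumber q ((2 * k : ℕ) + 1))
    fun k t => qCentralFactorial_add_one_sub_sub_one hq h2 (2 * k) t

theorem det_qCentralFactorial_two_mul (hq : q ≠ 0) (a : Fin m → ℤ) :
    (Matrix.of fun i k : Fin m => qCentralFactorial q (2 * k) (a i)).det =
      ∏ i : Fin m, ∏ j ∈ Finset.Ioi i, (qNumber q (a j) ^ 2 - qNumber q (a i) ^ 2) := by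
  rw [← Matrix.det_vandermonde fun i => qNumber q (a i) ^ 2,
    Matrix.det_eval_matrixOfPolynomials_eq_det_vandermonde _ fun k : Fin m =>
      ∏ l ∈ Finset.range k, (Polynomial.X - Polynomial.C (qNumber q (2 * l + 1) ^ 2))]
  · refine congrArg Matrix.det (Matrix.ext fun i k => ?_)
    simp [qCentralFactorial_two_mul hq, Polynomial.eval_prod]
  · intro k
    rw [Polynomial.natDegree_prod_of_monic _ _ fun l _ => Polynomial.monic_X_sub_C _]
    simp only [Polynomial.natDegree_X_sub_C, Finset.sum_const, Finset.card_range, smul_eq_mul,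
      mul_one]
  · exact fun k => Polynomial.monic_prod_of_monic _ _ fun l _ => Polynomial.monic_X_sub_C _

end Determinants

section Evaluation

variable {K : Type*} [Field K] {q : K} {m : ℕ} {L H j : ℤ}

theorem prod_range_two_mul {M : Type*} [CommMonoid M] (f : ℕ → M) (n : ℕ) :
    ∏ k ∈ Finset.range (2 * n), f k =
      (∏ k ∈ Finset.range n, f (2 * k + 1)) * ∏ k ∈ Finset.range n, f (2 * k) := by
  induction n with
  | zero => simp
  | succ n ih =>
    rw [mul_add_one, Finset.prod_range_succ, Finset.prod_range_succ, ih, Finset.prod_range_succ,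
      Finset.prod_range_succ]
    ac_rfl

/-- The zigzag side is met by adding a dent at the abscissa `0`, outside the region. -/
theorem tilingSum_dentedTrapezoid_of_odd {M : Type*} [CommSemiring M] {v : ℤ → M}
    (hjH : j + 1 < H) (hL : Odd L) (hj : Odd j) (hjL : j ≤ L) {r : Fin m → ℤ} (hr : StrictMono r)
    (hrI : ∀ i, (1 ≤ r i ∧ r i ≤ L - j) ∧ Even (r i)) :
    tilingSum (verticalWeight v) (dentedTrapezoid L H j (Finset.univ.image r)) =
      ∑ p ∈ interlacing (Fin.cons 0 r : Fin (m + 1) → ℤ), (∏ i, v (p i)) *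
        tilingSum (verticalWeight v) (dentedTrapezoid L H (j + 1) (Finset.univ.image p)) := by
  have himage : Finset.univ.image (Fin.cons 0 r : Fin (m + 1) → ℤ) =
      insert 0 (Finset.univ.image r) := by
    rw [Fin.univ_succ, Finset.cons_eq_insert, Finset.image_insert, Finset.map_eq_image,
      Finset.image_image]
    rfl
  rw [← dentedTrapezoid_insert_zero, ← himage]
  refine tilingSum_dentedTrapezoid (lo := 0) hjH hL (by simpa using hj) zero_le_one ?_ ?_ ?_
  · rw [himage]
    intro b hb
    grind
  · exact Fin.strictMono_cons.2 ⟨fun i => (hrI i).1.1, hr⟩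
  · refine Fin.cons ?_ fun i => ?_
    · simpa using hjL
    · have := hrI i
      rw [Fin.cons_succ]
      grind

theorem prod_mul_tilingSum_dentedTrapezoid_of_odd (hq : q ≠ 0) (h2 : (2 : K) ≠ 0) {c : K}
    (hjH : j + 1 < H) (hL : Odd L) (hj : Odd j) (hjL : j ≤ L) {r : Fin m → ℤ} (hr : StrictMono r)
    (hrI : ∀ i, (1 ≤ r i ∧ r i ≤ L - j) ∧ Even (r i))
    (hp : ∀ p : Fin m → ℤ, StrictMono p → (∀ i, (1 ≤ p i ∧ p i ≤ L - (j + 1)) ∧ Odd (p i)) →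
      c * tilingSum (verticalWeight (qCosh q)) (dentedTrapezoid L H (j + 1) (Finset.univ.image p)) =
        (Matrix.of fun i k : Fin m => qCentralFactorial q (2 * k) (p i)).det) :
    c * (∏ k ∈ Finset.range m, 2 * qNumber q ((2 * k : ℕ) + 1)) *
        tilingSum (verticalWeight (qCosh q)) (dentedTrapezoid L H j (Finset.univ.image r)) =
      (Matrix.of fun i k : Fin m => qCentralFactorial q (2 * k + 1) (r i)).det := by
  have hcons : StrictMono (Fin.cons 0 r : Fin (m + 1) → ℤ) :=
    Fin.strictMono_cons.2 ⟨fun i => (hrI i).1.1, hr⟩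
  have heven : ∀ i, Even ((Fin.cons 0 r : Fin (m + 1) → ℤ) i) :=
    Fin.cons (by simp) fun i => by simpa using (hrI i).2
  rw [tilingSum_dentedTrapezoid_of_odd hjH hL hj hjL hr hrI, mul_comm c, mul_assoc, Finset.mul_sum,
    ← sum_interlacing_det_qCentralFactorial_even hq h2 hcons.monotone fun i => (hrI i).2]
  refine congrArg _ (Finset.sum_congr rfl fun p hpi => ?_)
  rw [← hp p (strictMono_interlacing hpi) fun i => ?_, mul_left_comm]
  have hi := mem_interlacing.1 hpi i
  have hpos := hcons.monotone (Fin.zero_le i.castSucc)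
  have hpar := heven i.castSucc
  have := hrI i
  rw [Fin.cons_succ] at hi
  rw [Fin.cons_zero] at hpos
  exact ⟨by grind, by grind⟩

theorem prod_mul_tilingSum_dentedTrapezoid (hq : q ≠ 0) (h2 : (2 : K) ≠ 0) (hL : Odd L)
    (hj : Even j) {a : Fin (m + 1) → ℤ} (ha : StrictMono a)
    (haI : ∀ i, (1 ≤ a i ∧ a i ≤ L - j) ∧ Odd (a i)) :
    (∏ n ∈ Finset.range (m + 1), ∏ k ∈ Finset.range (2 * n), 2 * qNumber q (k + 1)) *
        tilingSum (verticalWeight (qCosh q))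
          (dentedTrapezoid L (j + 2 * m + 1) j (Finset.univ.image a)) =
      (Matrix.of fun i k : Fin (m + 1) => qCentralFactorial q (2 * k) (a i)).det := by
  induction m generalizing j with
  | zero =>
    have hone := tilingSum_dentedTrapezoid_one_row (v := qCosh q) hL hj (haI 0)
    simpa [qCentralFactorial_zero] using hone
  | succ m ih =>
    rw [Finset.prod_range_succ, prod_range_two_mul,
      tilingSum_dentedTrapezoid (lo := 1) (by lia) hL (by grind) le_rfl (by simp) ha
        (fun i => by have := haI i; grind),
      ← sum_interlacing_det_qCentralFactorial_odd hq h2 ha.monotone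
        (fun i => (haI _).2.sub_odd (haI _).2), mul_left_comm, mul_assoc, Finset.mul_sum]
    refine congrArg _ (Finset.sum_congr rfl fun r hr => ?_)
    rw [mul_left_comm]
    refine congrArg _ (prod_mul_tilingSum_dentedTrapezoid_of_odd hq h2 (by lia) hL hj.add_one
      ?_ (strictMono_interlacing hr) (fun i => ?_) fun p hp hpI => ?_)
    · have := haI 0
      grind
    · have hi := mem_interlacing.1 hr i
      have hcast := haI i.castSucc
      have hsucc := haI i.succ
      exact ⟨by grind, by grind⟩
    · rw [show j + 2 * ((m + 1 : ℕ) : ℤ) + 1 = j + 1 + 1 + 2 * m + 1 by lia]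
      exact ih (by grind) hp hpI

end Evaluation

section QuarteredHexagon

theorem prod_zpow_eq_zpow_sum {ι G : Type*} [CommGroupWithZero G] {q : G} (hq : q ≠ 0)
    (s : Finset ι) (e : ι → ℤ) : ∏ i ∈ s, q ^ e i = q ^ ∑ i ∈ s, e i := by
  classical
  induction s using Finset.induction_on with
  | empty => simp
  | insert i s hi ih => rw [Finset.prod_insert hi, Finset.sum_insert hi, zpow_add₀ hq, ih]

theorem prod_Iio_val {M : Type*} [CommMonoid M] {n : ℕ} (j : Fin n) (f : ℕ → M) :
    ∏ i ∈ Finset.Iio j, f i = ∏ i ∈ Finset.range j, f i := by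
  rw [← Nat.Iio_eq_range, ← Fin.map_valEmbedding_Iio, Finset.prod_map]
  rfl

theorem prod_prod_Ioi_comm {M : Type*} [CommMonoid M] {n : ℕ} (f : Fin n → Fin n → M) :
    ∏ i : Fin n, ∏ j ∈ Finset.Ioi i, f i j = ∏ j : Fin n, ∏ i ∈ Finset.Iio j, f i j :=
  Finset.prod_comm' fun i j => by simp

variable {K : Type*} [Field K] {q : K} {n : ℕ}

theorem prod_qFactorial_two_mul (q : K) (n : ℕ) :
    ∏ i : Fin n, qFactorial q (2 * (i : ℕ)) =
      (∏ i : Fin n, ∏ j ∈ Finset.Ioi i, qInt q ((i : ℕ) + (j : ℕ) + 1)) *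
        ∏ i : Fin n, ∏ j ∈ Finset.Ioi i, qInt q ((j : ℕ) - (i : ℕ)) := by
  rw [prod_prod_Ioi_comm, prod_prod_Ioi_comm, ← Finset.prod_mul_distrib]
  refine Finset.prod_congr rfl fun j _ => ?_
  rw [prod_Iio_val j fun i => qInt q (i + j + 1), prod_Iio_val j fun i => qInt q (j - i),
    qFactorial, two_mul, Finset.prod_range_add, mul_comm,
    ← Finset.prod_range_reflect (fun k => qInt q (k + 1))]
  refine congrArg₂ _ (Finset.prod_congr rfl fun i _ => by rw [add_comm i])
    (Finset.prod_congr rfl fun i hi => ?_)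
  have := Finset.mem_range.1 hi
  exact congrArg _ (by lia)

theorem qFactorial_ne_zero {m : ℕ} (h : ∀ k, 1 ≤ k → k ≤ m → qInt q k ≠ 0) :
    qFactorial q m ≠ 0 :=
  Finset.prod_ne_zero_iff.2 fun k hk => h (k + 1) (by lia) (Finset.mem_range.1 hk)

theorem prod_qNumber_eq_qFactorial (hq : q ≠ 0) (m : ℕ) :
    ∏ k ∈ Finset.range m, qNumber q (k + 1) =
      q ^ (-(m.choose 2 : ℤ)) * qFactorial (q ^ 2) m := by
  induction m with
  | zero => simp [qFactorial]
  | succ m ih =>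
    have hqNumber := qNumber_natCast hq (m + 1)
    have hexp : -((m + 1).choose 2 : ℤ) = -(m.choose 2 : ℤ) + (1 - ((m + 1 : ℕ) : ℤ)) := by
      rw [Nat.choose_succ_succ' m 1, Nat.choose_one_right]
      push_cast
      ring
    rw [Finset.prod_range_succ, ih, ← Nat.cast_add_one, hqNumber, hexp, zpow_add₀ hq, qFactorial,
      qFactorial, Finset.prod_range_succ]
    ring

theorem prod_prod_two_mul_qNumber (hq : q ≠ 0) (h2 : (2 : K) ≠ 0) (n : ℕ) :
    ∏ i ∈ Finset.range n, ∏ k ∈ Finset.range (2 * i), 2 * qNumber q (k + 1) =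
      2 ^ ((n : ℤ) * (n - 1)) * q ^ (-∑ i : Fin n, ((i : ℕ) : ℤ) * (2 * (i : ℕ) - 1)) *
        ∏ i : Fin n, qFactorial (q ^ 2) (2 * (i : ℕ)) := by
  have hchoose (i : ℕ) : ((2 * i).choose 2 : ℤ) = i * (2 * i - 1) := by
    rw [Nat.choose_two_right, mul_assoc, Nat.mul_div_cancel_left _ two_pos]
    cases i with
    | zero => simp
    | succ i => push_cast [show 2 * (i + 1) - 1 = 2 * i + 1 by lia]; ring
  have hsum : ∑ i : Fin n, (2 * (i : ℕ) : ℤ) = n * ((n : ℤ) - 1) := by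
    induction n with
    | zero => simp
    | succ n ih =>
      rw [Fin.sum_univ_castSucc]
      simp only [Fin.val_castSucc, Fin.val_last, ih]
      push_cast
      ring
  rw [← hsum, ← Finset.sum_neg_distrib, ← prod_zpow_eq_zpow_sum h2, ← prod_zpow_eq_zpow_sum hq,
    ← Finset.prod_mul_distrib, ← Finset.prod_mul_distrib, Finset.prod_range]
  refine Finset.prod_congr rfl fun i _ => ?_
  rw [Finset.prod_mul_distrib, prod_qNumber_eq_qFactorial hq, hchoose, Finset.prod_const,
    Finset.card_range, mul_assoc]
  norm_cast

theorem qNumber_sq_sub_qNumber_sq (hq : q ≠ 0) {s t : ℕ} (hs : 1 ≤ s) (hst : s ≤ t) :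
    qNumber q (2 * t - 1) ^ 2 - qNumber q (2 * s - 1) ^ 2 =
      q ^ (4 - 4 * (t : ℤ)) * (qInt (q ^ 2) (2 * (s + t - 1)) * qInt (q ^ 2) (2 * (t - s))) := by
  have hadd : (2 * t - 1 + (2 * s - 1) : ℤ) = (2 * (s + t - 1) : ℕ) := by lia
  have hsub : (2 * t - 1 - (2 * s - 1) : ℤ) = (2 * (t - s) : ℕ) := by lia
  rw [← qNumber_add_mul_qNumber_sub hq, hadd, hsub, qNumber_natCast hq, qNumber_natCast hq,
    mul_mul_mul_comm, ← zpow_add₀ hq]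
  exact congrArg (q ^ · * _) (by lia)

theorem prod_qNumber_sq_sub_qNumber_sq (hq : q ≠ 0) {s : Fin n → ℕ} (hs : Monotone s)
    (hpos : ∀ i, 1 ≤ s i) :
    ∏ i : Fin n, ∏ j ∈ Finset.Ioi i,
        (qNumber q (2 * (s j : ℤ) - 1) ^ 2 - qNumber q (2 * (s i : ℤ) - 1) ^ 2) =
      q ^ (∑ i : Fin n, ((i : ℕ) : ℤ) * (4 - 4 * (s i : ℤ))) *
        ∏ i : Fin n, ∏ j ∈ Finset.Ioi i,
          qInt (q ^ 2) (2 * (s i + s j - 1)) * qInt (q ^ 2) (2 * (s j - s i)) := by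
  have hpow : ∏ i : Fin n, ∏ j ∈ Finset.Ioi i, q ^ (4 - 4 * (s j : ℤ)) =
      q ^ (∑ i : Fin n, ((i : ℕ) : ℤ) * (4 - 4 * (s i : ℤ))) := by
    rw [prod_prod_Ioi_comm, ← prod_zpow_eq_zpow_sum hq]
    refine Finset.prod_congr rfl fun j _ => ?_
    rw [Finset.prod_const, Fin.card_Iio, mul_comm ((j : ℕ) : ℤ), zpow_mul, zpow_natCast]
  rw [← hpow, ← Finset.prod_mul_distrib]
  refine Finset.prod_congr rfl fun i _ => ?_
  rw [← Finset.prod_mul_distrib]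
  exact Finset.prod_congr rfl fun j hj =>
    qNumber_sq_sub_qNumber_sq hq (hpos i) (hs (Finset.mem_Ioi.1 hj).le)

theorem quarteredHexagon_eq_dentedTrapezoid (x : ℕ) (s : Fin n → ℕ) :
    quarteredHexagon x s = dentedTrapezoid (2 * (x + n) - 1) (2 * n - 1) 0
      (Finset.univ.image fun i => 2 * (s i : ℤ) - 1) := by
  ext ⟨i, j⟩
  simp only [quarteredHexagon, trapezoid, baseTriangle, mem_dentedTrapezoid, Finset.mem_sdiff,
    Finset.mem_filter, Finset.mem_product, Finset.mem_Icc, Finset.mem_Ico, Finset.mem_image,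
    Finset.mem_univ, true_and, Prod.mk.injEq]
  grind

theorem prod_mul_tilingGF_quarteredHexagon (hq : q ≠ 0) (h2 : (2 : K) ≠ 0) {x : ℕ} {s : Fin n → ℕ}
    (hs : StrictMono s) (hs_range : ∀ i, 1 ≤ s i ∧ s i ≤ n + x) :
    (∏ i ∈ Finset.range n, ∏ k ∈ Finset.range (2 * i), 2 * qNumber q (k + 1)) *
        tilingGF q (quarteredHexagon x s) =
      ∏ i : Fin n, ∏ j ∈ Finset.Ioi i,
        (qNumber q (2 * (s j : ℤ) - 1) ^ 2 - qNumber q (2 * (s i : ℤ) - 1) ^ 2) := by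
  rw [quarteredHexagon_eq_dentedTrapezoid]
  cases n with
  | zero =>
    rw [dentedTrapezoid_eq_empty (by simp)]
    have hempty : tilingGF q ∅ = 1 := tilingSum_empty (symmetricWeight q)
    simpa using hempty
  | succ m =>
    have hmono : StrictMono fun i => 2 * (s i : ℤ) - 1 := fun i j hij => by
      have := hs hij
      grind
    rw [← det_qCentralFactorial_two_mul hq, ← prod_mul_tilingSum_dentedTrapezoid hq h2
      (L := 2 * (x + (m + 1 : ℕ)) - 1) (j := 0) (by grind) Even.zero hmono
      fun i => by have := hs_range i; grind]
    rw [show (0 + 2 * m + 1 : ℤ) = 2 * (m + 1 : ℕ) - 1 by lia]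
    rfl

theorem tilingGF_quarteredHexagon (hq : q ≠ 0) (h2 : (2 : K) ≠ 0) {x : ℕ} {s : Fin n → ℕ}
    (hden : ∀ m : ℕ, 1 ≤ m → m ≤ 2 * n - 2 → qInt (q ^ 2) m ≠ 0)
    (hs : StrictMono s) (hs_range : ∀ i, 1 ≤ s i ∧ s i ≤ n + x) :
    tilingGF q (quarteredHexagon x s) =
      (2 : K) ^ (-((n : ℤ) * ((n : ℤ) - 1))) *
      q ^ (-∑ i : Fin n, ((i : ℕ) : ℤ) * (4 * (s i : ℤ) - 2 * (((i : ℕ) : ℤ) + 1) - 1)) *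
      ((∏ i : Fin n, ∏ j ∈ Finset.Ioi i,
          qInt (q ^ 2) (2 * (s i + s j - 1)) * qInt (q ^ 2) (2 * (s j - s i))) /
        ∏ i : Fin n, qFactorial (q ^ 2) (2 * (i : ℕ))) := by
  have hfactorial : ∏ i : Fin n, qFactorial (q ^ 2) (2 * (i : ℕ)) ≠ 0 :=
    Finset.prod_ne_zero_iff.2 fun i _ =>
      qFactorial_ne_zero fun k hk hki => hden k hk (by lia)
  have hexp : -∑ i : Fin n, ((i : ℕ) : ℤ) * (4 * (s i : ℤ) - 2 * (((i : ℕ) : ℤ) + 1) - 1) =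
      ∑ i : Fin n, ((i : ℕ) : ℤ) * (4 - 4 * (s i : ℤ)) -
        -∑ i : Fin n, ((i : ℕ) : ℤ) * (2 * (i : ℕ) - 1) := by
    rw [sub_neg_eq_add, ← Finset.sum_neg_distrib, ← Finset.sum_add_distrib]
    exact Finset.sum_congr rfl fun i _ => by ring
  have key := prod_mul_tilingGF_quarteredHexagon hq h2 hs hs_range
  rw [prod_prod_two_mul_qNumber hq h2, prod_qNumber_sq_sub_qNumber_sq hq hs.monotone
    fun i => (hs_range i).1] at key
  rw [hexp, zpow_sub₀ hq, zpow_neg, eq_div_of_mul_eq ?_ ((mul_comm _ _).trans key)]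
  · field_simp
  · exact mul_ne_zero (mul_ne_zero (zpow_ne_zero _ h2) (zpow_ne_zero _ hq)) hfactorial

end QuarteredHexagon

/-- The index `i : Fin n` stands for the index `i + 1` in `1, …, n`. -/
theorem mainTheorem3 {K : Type*} [Field K] (q : K) (x n : ℕ) (s : Fin n → ℕ)
    (h2 : (2 : K) ≠ 0) (hq : q ≠ 0)
    (hden : ∀ m : ℕ, 1 ≤ m → m ≤ 2 * n - 2 → qInt (q ^ 2) m ≠ 0)
    (hs : StrictMono s) (hs_range : ∀ i, 1 ≤ s i ∧ s i ≤ n + x) :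
    tilingGF q (quarteredHexagon x s) =
        (2 : K) ^ (-((n : ℤ) * ((n : ℤ) - 1))) *
        q ^ (-∑ i : Fin n, ((i : ℕ) : ℤ) * (4 * (s i : ℤ) - 2 * (((i : ℕ) : ℤ) + 1) - 1)) *
        ((∏ i : Fin n, ∏ j ∈ Finset.Ioi i,
            qInt (q ^ 2) (2 * (s i + s j - 1)) * qInt (q ^ 2) (2 * (s j - s i))) /
          ∏ i : Fin n, qFactorial (q ^ 2) (2 * (i : ℕ))) ∧
    tilingGF q (quarteredHexagon x s) =
        (2 : K) ^ (-((n : ℤ) * ((n : ℤ) - 1))) *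
        q ^ (-∑ i : Fin n, ((i : ℕ) : ℤ) * (4 * (s i : ℤ) - 2 * (((i : ℕ) : ℤ) + 1) - 1)) *
        (∏ i : Fin n, ∏ j ∈ Finset.Ioi i,
            qInt (q ^ 2) (2 * (s i + s j - 1)) / qInt (q ^ 2) ((i : ℕ) + (j : ℕ) + 1)) *
        ∏ i : Fin n, ∏ j ∈ Finset.Ioi i,
            qInt (q ^ 2) (2 * (s j - s i)) / qInt (q ^ 2) ((j : ℕ) - (i : ℕ)) := by
  have key := tilingGF_quarteredHexagon hq h2 hden hs hs_range
  refine ⟨key, key.trans ?_⟩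
  rw [prod_qFactorial_two_mul, mul_assoc (_ * _) (Finset.prod _ _) (Finset.prod _ _)]
  simp only [Finset.prod_mul_distrib, Finset.prod_div_distrib, div_mul_div_comm]
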